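/- **Setting.** Let $\mathrm{Mod}(n)$ be the lattice of linear subspaces of $\mathbb{R}^n$ and $\mathrm{Flag}(n)$ the space of complete flags $F_0\subseteq F_1\subseteq\cdots\subseteq F_n$ with $\dim F_k=k$. Let $\omega_k$ be the volume of the unit ball of $\mathbb{R}^k$, and put $[k]_{\mathbb{R}}=\frac{k\,\omega_k}{2\,\omega_{k-1}}$, $[k]_{\mathbb{R}}!=[k]_{\mathbb{R}}[k-1]_{\mathbb{R}}\cdots[1]_{\mathbb{R}}$. For integers $a_1,\dots,a_{r+1}\ge 1$ with $a_1+\cdots+a_{r+1}=n$ let $$\genfrac{[}{]}{0pt}{}{n}{a_1,\ldots,a_{r+1}}_{\mathbb{R}}=\frac{[n]_{\mathbb{R}}!}{[a_1]_{\mathbb{R}}!\cdots[a_{r+1}]_{\mathbb{R}}!}$$ be the multiflag coefficient. Let $\phi_n$ be the $O(n)$-invariant (Haar) measure on $\mathrm{Flag}(n)$ of total mass $[n]_{\mathbb{R}}!$. An *$r$-chain* is a tuple $(C_1,\dots,C_r)$ of nonzero subspaces of $\mathbb{R}^n$ with $C_1\subsetneq\cdots\subsetneq C_r$. For a family $\mathcal{C}$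 of $r$-chains let $\mathcal{C}_k=\{C_k : (C_1,\dots,C_r)\in\mathcal{C}\}$ for $1\le k\le r$, and for positive integers $a_1,\dots,a_{r+1}$ with sum $n$ let $\mathcal{C}_{a_1,\dots,a_r}$ be the set of all $(C_1,\dots,C_r)\in\mathcal{C}$ with $\dim C_i=a_1+\cdots+a_i$ for $i=1,\dots,r$. The invariant measure $\mu^n_{a_1,\dots,a_r}$ on the $r$-chains with these dimensions is the one induced from $\phi_n$: $$\mu^n_{a_1,\dots,a_r}(\mathcal{A})=\frac{\phi_n\big(\{F\in\mathrm{Flag}(n) : (F_{a_1},F_{a_1+a_2},\dots,F_{a_1+\cdots+a_r})\in\mathcal{A}\}\big)}{[a_1]_{\mathbb{R}}!\cdots[a_{r+1}]_{\mathbb{R}}!},$$ so that its total mass is $\genfrac{[}{]}{0pt}{}{n}{a_1,\ldots,a_{r+1}}_{\mathbb{R}}$. Put $\mu_{n;r}(\mathcal{C})=\sum_{a_1+\cdots+a_{r+1}=n}\mu^n_{a_1,\dots,a_r}(\mathcal{C}_{a_1,\dots,a_r})$; here and below the sums are over positive integers $a_1,\dots,a_{r+1}$. A family of subspaces is *$t$-chain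 free* if it contains no $t+1$ distinct pairwise comparable members. **Theorem.** Let $t_1,\dots,t_r$ be positive integers and $\tau=t_1t_2\cdots t_r$. Let $\mathcal{C}$ be a family of $r$-chains in $\mathrm{Mod}(n)$ such that every $\mathcal{C}_{a_1,\dots,a_r}$ is $\mu^n_{a_1,\dots,a_r}$-measurable and $\mathcal{C}_k$ is $t_k$-chain free for each $k\in\{1,\dots,r\}$. Then $$\sum_{a_1+\cdots+a_{r+1}=n}\frac{\mu^n_{a_1,\dots,a_r}(\mathcal{C}_{a_1,\dots,a_r})}{\genfrac{[}{]}{0pt}{}{n}{a_1,\ldots,a_{r+1}}_{\mathbb{R}}}\le\tau .$$ Consequently, $$\mu_{n;r}(\mathcal{C})\le m_1+\cdots+m_\tau ,$$ where $m_1\ge m_2\ge\cdots$ are the multiflag coefficients $\genfrac{[}{]}{0pt}{}{n}{a_1,\ldots,a_{r+1}}_{\mathbb{R}}$, one for each tuple of positive integers $a_1,\dots,a_{r+1}$ with $a_1+\cdots+a_{r+1}=n$, in decreasing order, and $m_i=0$ for $i$ greater than the number $\binom{n-1}{r}$ of such tuples. -/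

import Mathlib

open scoped BigOperators
open MeasureTheory

noncomputable section

/-- The subspace lattice `Mod(n)` of `ℝⁿ`, ordered by inclusion. -/
abbrev ModLat (n : ℕ) : Type := Submodule ℝ (EuclideanSpace ℝ (Fin n))

/-- The usual topology on the set of all subspaces of `ℝⁿ`: a subspace is identified with the
orthogonal projection onto it. On each `Gr(n,k)` this is the topology of the Grassmann manifold. -/
instance ModLat.instTopologicalSpace (n : ℕ) : TopologicalSpace (ModLat n) :=
  TopologicalSpace.induced (fun V : ModLat n => V.starProjection) inferInstance

/-- `Mod(n)` carries its Borel `σ`-algebra. -/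
instance ModLat.instMeasurableSpace (n : ℕ) : MeasurableSpace (ModLat n) := borel _

instance ModLat.instBorelSpace (n : ℕ) : BorelSpace (ModLat n) := ⟨rfl⟩

/-! ### The real analogues of integers, factorials and multinomial coefficients -/

/-- `ω n`, the volume of the unit ball of `ℝⁿ`. -/
def ballVolume (n : ℕ) : ℝ :=
  (volume : Measure (EuclideanSpace ℝ (Fin n))).real (Metric.ball 0 1)

/-- `[n]_ℝ = n ω_n / (2 ω_{n-1})` (used for `n ≥ 1`). -/
def realBracket (n : ℕ) : ℝ := n * ballVolume n / (2 * ballVolume (n - 1))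

/-- `[n]_ℝ! = [n]_ℝ [n-1]_ℝ ⋯ [1]_ℝ`. -/
def realFactorial (n : ℕ) : ℝ := ∏ i ∈ Finset.Icc 1 n, realBracket i

/-- The multiflag coefficient `[n; a_1, …, a_s]_ℝ = [n]_ℝ! / ([a_1]_ℝ! ⋯ [a_s]_ℝ!)`. -/
def multiflag (n : ℕ) {s : ℕ} (a : Fin s → ℕ) : ℝ :=
  realFactorial n / ∏ i, realFactorial (a i)

lemma ballVolume_pos (n : ℕ) : 0 < ballVolume n :=
  ENNReal.toReal_pos (Metric.measure_ball_pos _ _ one_pos).ne' measure_ball_lt_top.ne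

lemma realFactorial_pos (n : ℕ) : 0 < realFactorial n := by
  refine Finset.prod_pos fun i hi => ?_
  have h1 : (0 : ℝ) < i := by exact_mod_cast (Finset.mem_Icc.mp hi).1
  have h2 := ballVolume_pos i
  have h3 := ballVolume_pos (i - 1)
  unfold realBracket
  positivity

/-! ### Complete flags and their invariant measure -/

/-- `Flag(n)`: complete flags `F_0 ⊆ F_1 ⊆ ⋯ ⊆ F_n` with `dim F_k = k`, with the `σ`-algebra
inherited from the product of `n + 1` copies of `Mod(n)`. -/
abbrev FlagSpace (n : ℕ) : Type :=
  {F : Fin (n + 1) → ModLat n // Monotone F ∧ ∀ k, Module.finrank ℝ (F k) = k}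

/-- The orthogonal group `O(n)`. -/
abbrev OrthGroup (n : ℕ) : Type := Matrix.orthogonalGroup (Fin n) ℝ

instance OrthGroup.instMeasurableSpace (n : ℕ) : MeasurableSpace (OrthGroup n) := borel _

instance OrthGroup.instBorelSpace (n : ℕ) : BorelSpace (OrthGroup n) := ⟨rfl⟩

instance OrthGroup.instIsTopologicalGroup (n : ℕ) : IsTopologicalGroup (OrthGroup n) :=
  inferInstanceAs (IsTopologicalGroup (unitary (Matrix (Fin n) (Fin n) ℝ)))

instance OrthGroup.instCompactSpace (n : ℕ) : CompactSpace (OrthGroup n) := by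
  have hbox : IsCompact (Set.pi Set.univ fun _ : Fin n => Set.pi Set.univ
      fun _ : Fin n => Metric.closedBall (0 : ℝ) 1) :=
    isCompact_univ_pi fun _ => isCompact_univ_pi fun _ => isCompact_closedBall _ _
  have hclosed : IsClosed ((Matrix.orthogonalGroup (Fin n) ℝ : Submonoid _) :
      Set (Matrix (Fin n) (Fin n) ℝ)) := by
    have : ((Matrix.orthogonalGroup (Fin n) ℝ : Submonoid _) :
        Set (Matrix (Fin n) (Fin n) ℝ)) = {A | A * star A = 1} := by
      ext A
      exact Matrix.mem_orthogonalGroup_iff (Fin n) ℝ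
    rw [this]
    exact isClosed_eq (by fun_prop) continuous_const
  refine isCompact_iff_compactSpace.mp (hbox.of_isClosed_subset hclosed fun A hA => ?_)
  intro i _ j _
  simpa using entry_norm_bound_of_unitary hA i j

/-- The isometry `x ↦ A x` of `ℝⁿ` given by an orthogonal matrix `A`. -/
def OrthGroup.toIso {n : ℕ} (A : OrthGroup n) :
    EuclideanSpace ℝ (Fin n) ≃ₗᵢ[ℝ] EuclideanSpace ℝ (Fin n) :=
  Unitary.linearIsometryEquiv
    ⟨Matrix.toEuclideanCLM (n := Fin n) (𝕜 := ℝ) A.1, Unitary.map_mem _ A.2⟩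

lemma OrthGroup.toIso_apply {n : ℕ} (A : OrthGroup n) (x : EuclideanSpace ℝ (Fin n)) :
    A.toIso x = Matrix.toEuclideanLin A.1 x := rfl

lemma OrthGroup.toIso_mul {n : ℕ} (A B : OrthGroup n) (x : EuclideanSpace ℝ (Fin n)) :
    (A * B).toIso x = A.toIso (B.toIso x) :=
  congr($(map_mul (Matrix.toEuclideanCLM (n := Fin n) (𝕜 := ℝ)) A.1 B.1) x)

lemma OrthGroup.toIso_symm {n : ℕ} (A : OrthGroup n) (x : EuclideanSpace ℝ (Fin n)) :
    A.toIso.symm x = A⁻¹.toIso x := by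
  rw [LinearIsometryEquiv.symm_apply_eq, ← OrthGroup.toIso_mul, mul_inv_cancel]
  exact congr($((map_one (Matrix.toEuclideanCLM (n := Fin n) (𝕜 := ℝ))).symm) x)

/-- The image `A V` of a subspace `V` of `ℝⁿ` under `A ∈ O(n)`. -/
def OrthGroup.moveSubspace {n : ℕ} (A : OrthGroup n) (V : ModLat n) : ModLat n :=
  V.map (A.toIso.toLinearEquiv : EuclideanSpace ℝ (Fin n) →ₗ[ℝ] EuclideanSpace ℝ (Fin n))

/-- The action of `O(n)` on `Flag(n)`: `A (F_0, …, F_n) = (A F_0, …, A F_n)`. -/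
def OrthGroup.moveFlag {n : ℕ} (A : OrthGroup n) (F : FlagSpace n) : FlagSpace n :=
  ⟨fun k => A.moveSubspace (F.1 k), fun _ _ h => Submodule.map_mono (F.2.1 h), fun k =>
    (LinearEquiv.finrank_map_eq A.toIso.toLinearEquiv (F.1 k)).trans (F.2.2 k)⟩

/-- The standard flag: `F_k` is spanned by the first `k` standard basis vectors. -/
def standardFlag (n : ℕ) : FlagSpace n :=
  ⟨fun k => Submodule.span ℝ
      (Set.range fun i : Fin (k : ℕ) => EuclideanSpace.basisFun (Fin n) ℝ (Fin.castLE k.is_le i)),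
    by
      intro k l h
      refine Submodule.span_mono ?_
      rintro _ ⟨i, rfl⟩
      exact ⟨Fin.castLE h i, rfl⟩,
    fun k => by
      have hli := (EuclideanSpace.basisFun (Fin n) ℝ).orthonormal.linearIndependent.comp
        (Fin.castLE k.is_le) (Fin.castLE_injective k.is_le)
      exact (finrank_span_eq_card hli).trans (Fintype.card_fin _)⟩

/-- The Haar measure of the compact group `O(n)`, of total mass `1`. -/
def orthHaar (n : ℕ) : Measure (OrthGroup n) := Measure.haarMeasure ⊤

/-- The `O(n)`-invariant measure `φ_n` on `Flag(n)`, of total mass `[n]_ℝ!`: the orbit map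
`A ↦ A F` of the standard flag `F` carries the Haar measure of `O(n)` to it, up to that factor. -/
def flagMeasure (n : ℕ) : Measure (FlagSpace n) :=
  ENNReal.ofReal (realFactorial n) • (orthHaar n).map fun A => A.moveFlag (standardFlag n)

lemma OrthGroup.continuous_moveSubspace {n : ℕ} (V : ModLat n) :
    Continuous fun A : OrthGroup n => A.moveSubspace V := by
  let T : OrthGroup n → (EuclideanSpace ℝ (Fin n) →L[ℝ] EuclideanSpace ℝ (Fin n)) :=
    fun A => Matrix.toEuclideanCLM (n := Fin n) (𝕜 := ℝ) A.1
  have hlin : Continuous fun M : Matrix (Fin n) (Fin n) ℝ =>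
      Matrix.toEuclideanCLM (n := Fin n) (𝕜 := ℝ) M :=
    LinearMap.continuous_of_finiteDimensional
      (Matrix.toEuclideanCLM (n := Fin n) (𝕜 := ℝ)).toAlgEquiv.toLinearMap
  have hT : Continuous T := hlin.comp continuous_subtype_val
  have hT' : Continuous fun A : OrthGroup n => T A⁻¹ := hT.comp continuous_inv
  refine continuous_induced_rng.mpr ?_
  have : ((fun W : ModLat n => W.starProjection) ∘ fun A : OrthGroup n => A.moveSubspace V) =
      fun A => (T A).comp (V.starProjection.comp (T A⁻¹)) := by
    funext A
    ext1 x
    have h := Submodule.starProjection_map_apply A.toIso V x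
    rw [OrthGroup.toIso_symm] at h
    exact h
  rw [this]
  exact hT.clm_comp (continuous_const.clm_comp hT')

lemma OrthGroup.measurable_moveFlag {n : ℕ} (F : FlagSpace n) :
    Measurable fun A : OrthGroup n => A.moveFlag F :=
  (measurable_pi_lambda _ fun k =>
    (OrthGroup.continuous_moveSubspace (F.1 k)).measurable).subtype_mk

lemma flagMeasure_univ (n : ℕ) :
    flagMeasure n Set.univ = ENNReal.ofReal (realFactorial n) := by
  have h : orthHaar n Set.univ = 1 := Measure.haarMeasure_self
  rw [flagMeasure, Measure.smul_apply,
    Measure.map_apply (OrthGroup.measurable_moveFlag _) MeasurableSet.univ, Set.preimage_univ, h,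
    smul_eq_mul, mul_one]

lemma OrthGroup.moveFlag_mul {n : ℕ} (A B : OrthGroup n) (F : FlagSpace n) :
    (A * B).moveFlag F = A.moveFlag (B.moveFlag F) := by
  refine Subtype.ext (funext fun k => ?_)
  change Submodule.map _ _ = Submodule.map _ (Submodule.map _ _)
  rw [← Submodule.map_comp]
  congr 1
  exact LinearMap.ext (OrthGroup.toIso_mul A B)

lemma OrthGroup.measurable_moveFlag_right {n : ℕ} (A : OrthGroup n) :
    Measurable fun F : FlagSpace n => A.moveFlag F := by
  have hc : Continuous fun V : ModLat n => A.moveSubspace V := by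
    refine continuous_induced_rng.mpr ?_
    have : ((fun W : ModLat n => W.starProjection) ∘ fun V : ModLat n => A.moveSubspace V) =
        fun V => (Matrix.toEuclideanCLM (n := Fin n) (𝕜 := ℝ) A.1).comp (V.starProjection.comp
          (Matrix.toEuclideanCLM (n := Fin n) (𝕜 := ℝ) (A⁻¹).1)) := by
      funext V
      ext1 x
      have h := Submodule.starProjection_map_apply A.toIso V x
      rw [OrthGroup.toIso_symm] at h
      exact h
    rw [this]
    exact continuous_const.clm_comp (continuous_induced_dom.clm_comp continuous_const)
  exact (measurable_pi_lambda _ fun k => hc.measurable.comp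
    ((measurable_pi_apply k).comp measurable_subtype_coe)).subtype_mk

lemma flagMeasure_invariant {n : ℕ} (A : OrthGroup n) :
    (flagMeasure n).map (fun F => A.moveFlag F) = flagMeasure n := by
  have h : (orthHaar n).map (fun B => A * B) = orthHaar n := by
    unfold orthHaar
    exact map_mul_left_eq_self _ A
  unfold flagMeasure
  rw [Measure.map_smul, Measure.map_map A.measurable_moveFlag_right
    (OrthGroup.measurable_moveFlag _)]
  conv_rhs => rw [← h, Measure.map_map (OrthGroup.measurable_moveFlag _) (measurable_const_mul A)]
  congr 2
  funext B
  exact (OrthGroup.moveFlag_mul A B _).symm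

instance flagMeasure.instIsFiniteMeasure (n : ℕ) : IsFiniteMeasure (flagMeasure n) :=
  ⟨by rw [flagMeasure_univ]; exact ENNReal.ofReal_lt_top⟩

/-! ### Strict chains of nonzero subspaces -/

/-- `𝒞(ℝⁿ, r)`: the tuples `(C_1, …, C_r)` of nonzero subspaces with `C_1 ⊊ ⋯ ⊊ C_r`. -/
def strictChains (n r : ℕ) : Set (Fin r → ModLat n) :=
  {c | StrictMono c ∧ ∀ i, c i ≠ ⊥}

/-- The finite set of tuples `(a_1, …, a_s)` of positive integers with `a_1 + ⋯ + a_s = n`. -/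
def compositions (n s : ℕ) : Finset (Fin s → ℕ) :=
  (Finset.Nat.antidiagonalTuple s n).filter fun a => ∀ i, 0 < a i

/-- `a_1 + ⋯ + a_i` for `1 ≤ i ≤ r` (`i` is shifted by one), where `a = (a_1, …, a_{r+1})`. -/
def partialSum {r : ℕ} (a : Fin (r + 1) → ℕ) (i : Fin r) : ℕ := ∑ j ∈ Finset.Iic i.castSucc, a j

lemma partialSum_lt {n r : ℕ} {a : Fin (r + 1) → ℕ} (ha : a ∈ compositions n (r + 1))
    (i : Fin r) : partialSum a i < n + 1 := by
  have h := (Finset.mem_filter.mp ha).1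
  rw [Finset.Nat.mem_antidiagonalTuple] at h
  have : partialSum a i ≤ ∑ j, a j := Finset.sum_le_sum_of_subset (Finset.subset_univ _)
  omega

/-- `𝒞_{a_1,…,a_r}`: the chains in `𝒞` with `dim C_i = a_1 + ⋯ + a_i` for `i = 1, …, r`. -/
def ofType {n r : ℕ} (C : Set (Fin r → ModLat n)) (a : Fin (r + 1) → ℕ) :
    Set (Fin r → ModLat n) :=
  {c ∈ C | ∀ i, Module.finrank ℝ (c i) = partialSum a i}

/-- `𝒞_k = {C_k | (C_1, …, C_k, …, C_r) ∈ 𝒞}`. -/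
def component {n r : ℕ} (C : Set (Fin r → ModLat n)) (k : Fin r) : Set (ModLat n) :=
  (fun c => c k) '' C

/-- A family of subspaces is `t`-chain free if it contains no chain of length `t`, that is, no
`t + 1` pairwise comparable members. -/
def ChainFree {n : ℕ} (t : ℕ) (𝒜 : Set (ModLat n)) : Prop :=
  ¬ ∃ s : Finset (ModLat n),
    (s : Set (ModLat n)) ⊆ 𝒜 ∧ IsChain (· ≤ ·) (s : Set (ModLat n)) ∧ s.card = t + 1

/-- The tuple `(F_{a_1}, F_{a_1+a_2}, …, F_{a_1+⋯+a_r})`: the only chain of type `a` with which the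
flag `F` is compatible. -/
def chainOfFlag {n r : ℕ} (a : compositions n (r + 1)) (F : FlagSpace n) : Fin r → ModLat n :=
  fun i => F.1 ⟨partialSum a.1 i, partialSum_lt a.2 i⟩

/-- The `O(n)`-invariant measure `μ^n_{a_1,…,a_r}` on the chains of type `a`, where
`a_{r+1} = n - (a_1 + ⋯ + a_r)`: it is induced from `φ_n`, so that the measure of `𝒞` is
`φ_n (Flag(𝒞)) / ([a_1]_ℝ! ⋯ [a_{r+1}]_ℝ!)`, where `Flag(𝒞)` is the set of the flags compatible
with some member of `𝒞`. It is regarded as a measure on all `r`-tuples of subspaces. -/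
def chainMeasure {n r : ℕ} (a : compositions n (r + 1)) : Measure (Fin r → ModLat n) :=
  (ENNReal.ofReal (∏ i, realFactorial (a.1 i)))⁻¹ • (flagMeasure n).map (chainOfFlag a)

lemma measurable_chainOfFlag {n r : ℕ} (a : compositions n (r + 1)) :
    Measurable (chainOfFlag a) :=
  measurable_pi_lambda _ fun _ => (measurable_pi_apply _).comp measurable_subtype_coe

/-- `Flag(𝒞)` for a family of chains of type `a`: the flags `F` that are compatible with some
`(C_1, …, C_r) ∈ 𝒞`, that is, `F_{a_1+⋯+a_i} = C_i` for all `i`. -/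
def compatibleFlags {n r : ℕ} (a : Fin (r + 1) → ℕ) (C : Set (Fin r → ModLat n)) :
    Set (FlagSpace n) :=
  {F | ∃ c ∈ C, ∀ (i : Fin r) (k : Fin (n + 1)), (k : ℕ) = partialSum a i → F.1 k = c i}

lemma preimage_chainOfFlag {n r : ℕ} (a : compositions n (r + 1))
    (C : Set (Fin r → ModLat n)) : chainOfFlag a ⁻¹' C = compatibleFlags a.1 C := by
  ext F
  constructor
  · intro hF
    refine ⟨_, hF, fun i k hk => ?_⟩
    exact congrArg F.1 (Fin.ext hk)
  · rintro ⟨c, hc, h⟩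
    have : chainOfFlag a F = c := funext fun i => h i _ rfl
    rw [Set.mem_preimage, this]
    exact hc

lemma prod_realFactorial_pos {s : ℕ} (a : Fin s → ℕ) : 0 < ∏ i, realFactorial (a i) :=
  Finset.prod_pos fun _ _ => realFactorial_pos _

lemma chainMeasure_apply {n r : ℕ} (a : compositions n (r + 1)) {C : Set (Fin r → ModLat n)}
    (hC : NullMeasurableSet C (chainMeasure a)) :
    chainMeasure a C =
      flagMeasure n (compatibleFlags a.1 C) / ENNReal.ofReal (∏ i, realFactorial (a.1 i)) := by
  have hC' : NullMeasurableSet C ((flagMeasure n).map (chainOfFlag a)) :=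
    hC.mono_ac (Measure.absolutelyContinuous_smul (ENNReal.inv_ne_zero.mpr ENNReal.ofReal_ne_top))
  rw [chainMeasure, Measure.smul_apply,
    Measure.map_apply₀ (measurable_chainOfFlag a).aemeasurable hC', preimage_chainOfFlag,
    smul_eq_mul, ENNReal.div_eq_inv_mul]

lemma chainMeasure_univ {n r : ℕ} (a : compositions n (r + 1)) :
    chainMeasure a Set.univ = ENNReal.ofReal (multiflag n a.1) := by
  rw [chainMeasure, Measure.smul_apply,
    Measure.map_apply (measurable_chainOfFlag a) MeasurableSet.univ, Set.preimage_univ,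
    flagMeasure_univ, smul_eq_mul, multiflag, ENNReal.ofReal_div_of_pos (prod_realFactorial_pos _),
    ENNReal.div_eq_inv_mul]

instance chainMeasure.instIsFiniteMeasure {n r : ℕ} (a : compositions n (r + 1)) :
    IsFiniteMeasure (chainMeasure a) :=
  ⟨by rw [chainMeasure_univ]; exact ENNReal.ofReal_lt_top⟩

lemma chainOfFlag_mem {n r : ℕ} (a : compositions n (r + 1)) (F : FlagSpace n) :
    chainOfFlag a F ∈ ofType (strictChains n r) a.1 := by
  have hpos : ∀ i, 0 < a.1 i := (Finset.mem_filter.mp a.2).2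
  have hdim : ∀ i, Module.finrank ℝ (chainOfFlag a F i) = partialSum a.1 i := fun i => F.2.2 _
  have hlt : ∀ i j : Fin r, i < j → partialSum a.1 i < partialSum a.1 j := by
    intro i j hij
    refine Finset.sum_lt_sum_of_subset (i := j.castSucc)
      (Finset.Iic_subset_Iic.mpr (Fin.castSucc_le_castSucc_iff.mpr hij.le)) (by simp)
      (by simpa using hij) (hpos _) (fun _ _ _ => Nat.zero_le _)
  refine ⟨⟨fun i j hij => ?_, fun i h => ?_⟩, hdim⟩
  · refine lt_of_le_of_ne (F.2.1 (Fin.mk_le_mk.mpr (hlt i j hij).le)) fun h => ?_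
    have := hlt i j hij
    rw [← hdim i, ← hdim j, h] at this
    exact lt_irrefl _ this
  · have h0 := hdim i
    rw [h, finrank_bot] at h0
    have : a.1 i.castSucc ≤ partialSum a.1 i :=
      Finset.single_le_sum (fun _ _ => Nat.zero_le _) (by simp)
    have := hpos i.castSucc
    omega

lemma chainMeasure_strictChains {n r : ℕ} (a : compositions n (r + 1)) :
    chainMeasure a (ofType (strictChains n r) a.1) = ENNReal.ofReal (multiflag n a.1) := by
  rw [← chainMeasure_univ]
  refine le_antisymm (measure_mono (Set.subset_univ _)) ?_
  rw [chainMeasure, Measure.smul_apply, Measure.smul_apply]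
  refine mul_le_mul_right ?_ _
  rw [Measure.map_apply (measurable_chainOfFlag a) MeasurableSet.univ, Set.preimage_univ]
  refine le_trans (measure_mono fun F _ => chainOfFlag_mem a F)
    (Measure.le_map_apply (measurable_chainOfFlag a).aemeasurable _)

/-- `μ_{n;r}(𝒞) = ∑_{a_1 + ⋯ + a_{r+1} = n} μ^n_{a_1,…,a_r}(𝒞_{a_1,…,a_r})`. -/
def totalMeasure {n r : ℕ} (C : Set (Fin r → ModLat n)) : ℝ :=
  ∑ a : compositions n (r + 1), (chainMeasure a).real (ofType C a.1)

/-- The sum of the `m` largest members of a finite family of nonnegative reals, counted with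
multiplicity (of all of its members, if there are fewer than `m`). -/
def sumLargest (m : ℕ) (M : Multiset ℝ) : ℝ := ((M.sort (· ≥ ·)).take m).sum

end

/-! This is the LYM argument with complete flags in place of maximal chains. A flag `F` is
compatible with exactly one chain of each type `a`, namely `chainOfFlag a F`. If that chain lies in
`C`, its `k`-th entry is both a member of `F` and a member of `component C k`; such subspaces are
pairwise comparable, so there are at most `t k` of them. The dimensions of the entries recover `a`,
so at most `∏ k, t k` types occur for a given `F` (`card_chainOfFlag_mem_le`). Integrating this
count over all flags gives the first inequality, because the normalised measure of `ofType C a` is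
the probability that a random flag is compatible with one of its members
(`chainMeasure_real_div_multiflag`).

For the second inequality, these probabilities are weights in `[0, 1]` of sum at most `∏ k, t k`,
and the total measure is the sum of the multiflag coefficients with these weights. Such a fractional
selection cannot beat taking the largest coefficients outright (`sum_mul_le_sumLargest`), by linear
programming duality with a threshold `c` as dual variable. -/

/-- The truncations of a decreasing list of nonnegative reals at a suitable level `c` witness
that the sum of its first `k` terms dominates. -/
lemma exists_threshold_le_take_sum (L : List ℝ) (hL : L.Pairwise (· ≥ ·)) (hL0 : ∀ l ∈ L, 0 ≤ l)
    (k : ℕ) : ∃ c : ℝ, 0 ≤ c ∧ (∀ b, 0 ≤ b → (∀ l ∈ L, l ≤ b) → c ≤ b) ∧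
      (L.map fun l => max (l - c) 0).sum + k * c ≤ (L.take k).sum := by
  induction L generalizing k with
  | nil => exact ⟨0, le_rfl, fun b hb _ => hb, by simp⟩
  | cons h L ih =>
    have hhead := (List.pairwise_cons.mp hL).1
    have hh : 0 ≤ h := hL0 h (by simp)
    cases k with
    | zero =>
      -- With nothing to select, the threshold is the largest entry, so every truncation vanishes.
      refine ⟨h, hh, fun b _ hb => hb h (by simp), ?_⟩
      have hzero : (List.map (fun l => max (l - h) 0) (h :: L)).sum = 0 := by
        refine List.sum_eq_zero fun x hx => ?_
        obtain ⟨l, hl, rfl⟩ := List.mem_map.mp hx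
        have : l ≤ h := by
          rcases List.mem_cons.mp hl with rfl | hl
          · exact le_rfl
          · exact hhead l hl
        exact max_eq_right (sub_nonpos.mpr this)
      simp only [hzero, Nat.cast_zero, zero_mul, add_zero, List.take_zero, List.sum_nil, le_refl]
    | succ k =>
      obtain ⟨c, hc0, hcb, hc⟩ := ih (List.pairwise_cons.mp hL).2
        (fun l hl => hL0 l (List.mem_cons_of_mem _ hl)) k
      -- The clause that `c` is below every nonnegative upper bound is carried through the induction
      -- for this step: the new head then contributes exactly `(h - c) + c = h`.
      have hch : c ≤ h := hcb h hh hhead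
      refine ⟨c, hc0, fun b hb hb' => hcb b hb fun l hl => hb' l (List.mem_cons_of_mem _ hl), ?_⟩
      rw [List.map_cons, List.sum_cons, List.take_succ_cons, List.sum_cons,
        max_eq_left (sub_nonneg.mpr hch)]
      push_cast
      linarith

/-- A fractional selection of total weight at most `k` weighs at most the `k` largest members. -/
lemma sum_mul_le_sumLargest {ι : Type*} (s : Finset ι) (m x : ι → ℝ) (hm : ∀ i ∈ s, 0 ≤ m i)
    (hx0 : ∀ i ∈ s, 0 ≤ x i) (hx1 : ∀ i ∈ s, x i ≤ 1) (k : ℕ) (hxk : ∑ i ∈ s, x i ≤ k) :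
    ∑ i ∈ s, m i * x i ≤ sumLargest k (s.val.map m) := by
  obtain ⟨c, hc0, -, hc⟩ := exists_threshold_le_take_sum ((s.val.map m).sort (· ≥ ·))
    (Multiset.pairwise_sort _ _) (fun l hl => by
      obtain ⟨i, hi, rfl⟩ := Multiset.mem_map.mp ((Multiset.mem_sort _).mp hl)
      exact hm i hi) k
  have hsum : (((s.val.map m).sort (· ≥ ·)).map fun l => max (l - c) 0).sum =
      ∑ i ∈ s, max (m i - c) 0 := by
    rw [← Multiset.sum_coe, ← Multiset.map_coe, Multiset.sort_eq, Multiset.map_map]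
    rfl
  rw [hsum] at hc
  -- Weak duality: split `m i = (m i - c) + c` and use `0 ≤ x i ≤ 1` on the first part, `∑ x i ≤ k`
  -- and `0 ≤ c` on the second.
  calc ∑ i ∈ s, m i * x i ≤ ∑ i ∈ s, (max (m i - c) 0 + c * x i) := by
        refine Finset.sum_le_sum fun i hi => ?_
        have h1 : (m i - c) * x i ≤ max (m i - c) 0 * x i :=
          mul_le_mul_of_nonneg_right (le_max_left _ _) (hx0 i hi)
        have h2 : max (m i - c) 0 * x i ≤ max (m i - c) 0 :=
          mul_le_of_le_one_right (le_max_right _ _) (hx1 i hi)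
        linarith
    _ = ∑ i ∈ s, max (m i - c) 0 + c * ∑ i ∈ s, x i := by
        rw [Finset.sum_add_distrib, Finset.mul_sum]
    _ ≤ ∑ i ∈ s, max (m i - c) 0 + k * c := by
        rw [mul_comm (k : ℝ)]
        gcongr
    _ ≤ _ := hc

lemma multiflag_pos (n : ℕ) {s : ℕ} (a : Fin s → ℕ) : 0 < multiflag n a :=
  div_pos (realFactorial_pos n) (prod_realFactorial_pos a)

/-! ### Counting the chains compatible with one flag -/

/-- A composition is determined by its partial sums. -/
lemma partialSum_injective {n r : ℕ} {a b : compositions n (r + 1)}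
    (h : ∀ i, partialSum a.1 i = partialSum b.1 i) : a = b := by
  have hsum : ∀ c : compositions n (r + 1), ∑ j, c.1 j = n := fun c =>
    Finset.Nat.mem_antidiagonalTuple.mp (Finset.mem_filter.mp c.2).1
  have hIic : ∀ j, ∑ l ∈ Finset.Iic j, a.1 l = ∑ l ∈ Finset.Iic j, b.1 l := by
    intro j
    -- `partialSum` omits the last index; there both sums equal `n`.
    induction j using Fin.lastCases with
    | last =>
      rw [show Finset.Iic (Fin.last r) = Finset.univ from Finset.Iic_top, hsum, hsum]
    | cast i => exact h i
  refine Subtype.ext (funext fun j => ?_)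
  induction j using WellFoundedLT.induction with
  | ind j ih =>
    have hj := hIic j
    rw [← Finset.Iio_insert, Finset.sum_insert (by simp), Finset.sum_insert (by simp),
      Finset.sum_congr rfl fun l hl => ih l (Finset.mem_Iio.mp hl)] at hj
    exact Nat.add_right_cancel hj

/-- The dimensions of the entries are the partial sums of the type. -/
lemma chainOfFlag_injective {n r : ℕ} (F : FlagSpace n) :
    Function.Injective fun a : compositions n (r + 1) => chainOfFlag a F := by
  intro a b hab
  refine partialSum_injective fun i => ?_
  have hi := congrArg (fun V : ModLat n => Module.finrank ℝ V) (congrFun hab i)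
  exact (F.2.2 _).symm.trans (hi.trans (F.2.2 _))

lemma ChainFree.card_le {n t : ℕ} {𝒜 : Set (ModLat n)} (h𝒜 : ChainFree t 𝒜)
    {s : Finset (ModLat n)} (hs : (s : Set (ModLat n)) ⊆ 𝒜)
    (hchain : IsChain (· ≤ ·) (s : Set (ModLat n))) : s.card ≤ t := by
  by_contra! hlt
  obtain ⟨u, hu, hcard⟩ := Finset.exists_subset_card_eq (Nat.succ_le_of_lt hlt)
  have hu' : (u : Set (ModLat n)) ⊆ s := Finset.coe_subset.mpr hu
  exact h𝒜 ⟨u, hu'.trans hs, hchain.mono hu', hcard⟩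

open Classical in
/-- A complete flag is compatible with at most `∏ k, t k` members of a family of chains whose
components are `t k`-chain free. -/
lemma card_chainOfFlag_mem_le {n r : ℕ} {t : Fin r → ℕ} {C : Set (Fin r → ModLat n)}
    (hfree : ∀ k, ChainFree (t k) (component C k)) (F : FlagSpace n) :
    (Finset.univ.filter fun a : compositions n (r + 1) => chainOfFlag a F ∈ C).card ≤
      ∏ k, t k := by
  -- `T k` holds the candidates for the `k`-th entry.
  let T : Fin r → Finset (ModLat n) := fun k =>
    (Finset.univ.image F.1).filter (· ∈ component C k)
  have hT : ∀ k, (T k).card ≤ t k := by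
    intro k
    refine (hfree k).card_le (fun V hV => (Finset.mem_filter.mp hV).2) ?_
    refine F.2.1.isChain_range.mono fun V hV => ?_
    obtain ⟨j, -, hj⟩ := Finset.mem_image.mp (Finset.mem_filter.mp hV).1
    exact ⟨j, hj⟩
  calc _ ≤ (Fintype.piFinset T).card := by
        refine Finset.card_le_card_of_injOn (fun a => chainOfFlag a F) (fun a ha => ?_)
          (chainOfFlag_injective F).injOn
        refine Fintype.mem_piFinset.mpr fun k => Finset.mem_filter.mpr ⟨?_, ?_⟩
        · exact Finset.mem_image_of_mem _ (Finset.mem_univ _)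
        · exact ⟨_, (Finset.mem_filter.mp ha).2, rfl⟩
    _ = ∏ k, (T k).card := Fintype.card_piFinset T
    _ ≤ ∏ k, t k := Finset.prod_le_prod' fun k _ => hT k

lemma chainOfFlag_mem_ofType {n r : ℕ} {C : Set (Fin r → ModLat n)}
    (a : compositions n (r + 1)) (F : FlagSpace n) :
    chainOfFlag a F ∈ ofType C a.1 ↔ chainOfFlag a F ∈ C :=
  ⟨fun h => h.1, fun h => ⟨h, (chainOfFlag_mem a F).2⟩⟩

/-! ### Passing to the flag measure -/

lemma nullMeasurableSet_preimage_chainOfFlag {n r : ℕ} (a : compositions n (r + 1))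
    {C : Set (Fin r → ModLat n)} (hC : NullMeasurableSet C (chainMeasure a)) :
    NullMeasurableSet (chainOfFlag a ⁻¹' C) (flagMeasure n) := by
  have hC' : NullMeasurableSet C ((flagMeasure n).map (chainOfFlag a)) :=
    hC.mono_ac (Measure.absolutelyContinuous_smul (ENNReal.inv_ne_zero.mpr ENNReal.ofReal_ne_top))
  exact hC'.preimage ⟨measurable_chainOfFlag a, Measure.AbsolutelyContinuous.rfl⟩

/-- The product of the factorials of the parts divides both the measure and the multiflag
coefficient, so it cancels. -/
lemma chainMeasure_real_div_multiflag {n r : ℕ} (a : compositions n (r + 1))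
    {C : Set (Fin r → ModLat n)} (hC : NullMeasurableSet C (chainMeasure a)) :
    (chainMeasure a).real C / multiflag n a.1 =
      (flagMeasure n).real (chainOfFlag a ⁻¹' C) / realFactorial n := by
  have hP := prod_realFactorial_pos a.1
  have hn := realFactorial_pos n
  rw [Measure.real, chainMeasure_apply a hC, ← preimage_chainOfFlag, ENNReal.toReal_div,
    ENNReal.toReal_ofReal hP.le, multiflag, ← Measure.real]
  field_simp

/-- A multiplicity bound: null measurable sets that cover no point more than `k` times have total
measure at most `k` times that of the space. -/
lemma sum_measureReal_le_of_card_le {α ι : Type*} [MeasurableSpace α] [Fintype ι]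
    (μ : Measure α) [IsFiniteMeasure μ] (S : ι → Set α) (hS : ∀ i, NullMeasurableSet (S i) μ)
    (k : ℕ) (hk : ∀ x, ∑ i, (S i).indicator (fun _ => (1 : ℝ)) x ≤ k) :
    ∑ i, μ.real (S i) ≤ k * μ.real Set.univ := by
  have hint : ∀ i, Integrable ((S i).indicator fun _ => (1 : ℝ)) μ := fun i =>
    (integrable_const (1 : ℝ)).indicator₀ (hS i)
  calc ∑ i, μ.real (S i) = ∑ i, ∫ x, (S i).indicator (fun _ => (1 : ℝ)) x ∂μ := by
        refine Finset.sum_congr rfl fun i _ => ?_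
        rw [integral_indicator₀ (hS i), setIntegral_const, smul_eq_mul, mul_one]
    _ = ∫ x, ∑ i, (S i).indicator (fun _ => (1 : ℝ)) x ∂μ :=
        (integral_finsetSum _ fun i _ => hint i).symm
    _ ≤ ∫ _, (k : ℝ) ∂μ :=
        integral_mono (integrable_finsetSum _ fun i _ => hint i) (integrable_const _) hk
    _ = k * μ.real Set.univ := by rw [integral_const, smul_eq_mul, mul_comm]

theorem theorem6 (n r : ℕ) (t : Fin r → ℕ) (ht : ∀ k, 0 < t k)
    (C : Set (Fin r → ModLat n)) (hC : C ⊆ strictChains n r)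
    (hmeas : ∀ a : compositions n (r + 1), NullMeasurableSet (ofType C a.1) (chainMeasure a))
    (hfree : ∀ k, ChainFree (t k) (component C k)) :
    (∑ a : compositions n (r + 1),
        (chainMeasure a).real (ofType C a.1) / multiflag n a.1 ≤ ((∏ k, t k : ℕ) : ℝ)) ∧
      totalMeasure C ≤
        sumLargest (∏ k, t k)
          ((compositions n (r + 1)).val.map fun a => multiflag n a) := by
  classical
  have hn := realFactorial_pos n
  have hfirst : ∑ a : compositions n (r + 1),
      (chainMeasure a).real (ofType C a.1) / multiflag n a.1 ≤ ((∏ k, t k : ℕ) : ℝ) := by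
    have hle := sum_measureReal_le_of_card_le (flagMeasure n)
      (fun a : compositions n (r + 1) => chainOfFlag a ⁻¹' ofType C a.1)
      (fun a => nullMeasurableSet_preimage_chainOfFlag a (hmeas a)) (∏ k, t k) fun F => by
        have hcard := card_chainOfFlag_mem_le hfree F
        simp only [Set.indicator_apply, Set.mem_preimage, chainOfFlag_mem_ofType, Finset.sum_boole]
        exact_mod_cast hcard
    rw [Finset.sum_congr rfl fun a _ => chainMeasure_real_div_multiflag a (hmeas a),
      ← Finset.sum_div, div_le_iff₀ hn]
    rwa [Measure.real, flagMeasure_univ, ENNReal.toReal_ofReal hn.le] at hle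
  refine ⟨hfirst, ?_⟩
  -- The coefficients are listed over a finset, the measures over its subtype.
  have hmap : (compositions n (r + 1)).val.map (fun a => multiflag n a) =
      (Finset.univ : Finset (compositions n (r + 1))).val.map fun a => multiflag n a.1 :=
    (Multiset.attach_map_val' _ _).symm
  rw [hmap, totalMeasure]
  calc _ = ∑ a : compositions n (r + 1),
        multiflag n a.1 * ((chainMeasure a).real (ofType C a.1) / multiflag n a.1) :=
        Finset.sum_congr rfl fun a _ => (mul_div_cancel₀ _ (multiflag_pos n a.1).ne').symm
    _ ≤ _ := by
        refine sum_mul_le_sumLargest _ (fun a : compositions n (r + 1) => multiflag n a.1) _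
          (fun a _ => (multiflag_pos n a.1).le)
          (fun a _ => div_nonneg measureReal_nonneg (multiflag_pos n a.1).le) (fun a _ => ?_) _
          hfirst
        -- Each weight is at most one, the coefficient being the total mass of `chainMeasure a`.
        refine (div_le_one (multiflag_pos n a.1)).mpr ?_
        refine (measureReal_mono (Set.subset_univ _)).trans_eq ?_
        rw [Measure.real, chainMeasure_univ, ENNReal.toReal_ofReal (multiflag_pos n a.1).le]
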